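/- For positive integers $k,m$ let $S_k(m)=1^k+2^k+\cdots+(m-1)^k$ (so $S_k(1)=0$), and let $B_k$ be the $k$-th Bernoulli number, defined by $\frac{z}{e^z-1}=\sum_{n\ge 0}B_n\frac{z^n}{n!}$. Write $B_k=N_k/D_k$ in lowest terms with $D_k>0$. For an integer $n\ge 1$ we write $n\mid B_k$ if $n\mid N_k$, and for rational numbers $x,y$ we write $x\equiv y\pmod n$ if $x-y=n\cdot\frac ab$ for some integers $a,b$ with $b\ne 0$ and $\gcd(b,n)=1$. For a prime $p$ and an integer $r\ge 0$, $p^r\,\|\,m$ means $p^r\mid m$ and $p^{r+1}\nmid m$. Let $k,m$ be positive integers with $k$ even. Then \begin{align*} S_k(m)&\equiv B_k\,m \pmod{m}, &&\text{if } k\ge 2,\\ S_k(m)&\equiv B_k\,m \pmod{m^2}, &&\text{if } k\ge 4 \text{ and } \gcd(D_k,m)=1,\\ S_k(m)&\equiv B_k\,m \pmod{m^3}, &&\text{if } k\ge 6 \text{ and } m\mid B_k. \end{align*} Moreover, for every prime $p$ and every integer $r \ge 0$ with $p^r\,\|\,m$, \begin{align*} S_k(m)&\equiv B_k\,m \pmod{p^{2r}},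 &&\text{if } k\ge 4 \text{ and } p\nmid D_k,\\ S_k(m)&\equiv B_k\,m \pmod{p^{3r}}, &&\text{if } k\ge 6 \text{ and } p\mid B_k. \end{align*} -/

import Mathlib

/-- The power sum `S_k(m) = 1^k + 2^k + ⋯ + (m-1)^k`. -/
def powerSum (k m : ℕ) : ℕ :=
  ∑ j ∈ Finset.Ico 1 m, j ^ k

/-- The numerator `N_k` of the Bernoulli number `B_k` (generating function `z / (e^z - 1)`),
written in lowest terms with positive denominator. -/
def bernoulliNum (k : ℕ) : ℤ := (bernoulli k).num

/-- The denominator `D_k > 0` of the Bernoulli number `B_k` in lowest terms. -/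
def bernoulliDen (k : ℕ) : ℕ := (bernoulli k).den

/-- Congruence of rational numbers modulo `n`: `x ≡ y (mod n)` means that `x - y = n * (a / b)`
for integers `a`, `b` with `b ≠ 0` and `b` coprime to `n`. In particular, if `x` is an integer,
then `y` has denominator coprime to `n`. -/
def RatModEq (n : ℕ) (x y : ℚ) : Prop :=
  ∃ a b : ℤ, b ≠ 0 ∧ IsCoprime b (n : ℤ) ∧ x - y = (n : ℚ) * ((a : ℚ) / (b : ℚ))

/-! Everything is checked one prime `p ∣ m` at a time. Faulhaber's formula writes `S_k(m) - B_k m`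
as a sum of terms `B_i C(k,i) m^(d+1)/(d+1)` with `d = k - i > 0`. By von Staudt–Clausen `p B_i` is
`p`-integral for even `i`, so one factor `m` absorbs the denominator of `B_i`; after division by
`m^s` it suffices that `v_p(d+1) ≤ d - s`. This settles `s = 1`, and `s = 2` too, since
`p`-integrality of `B_k` forces `p ≥ 5`.

For `s = 3` only `d = 2` escapes: `B_(k-2) C(k,2)/3` has no factor `m` left, which matters only if
`p - 1 ∣ k - 2`. Then `p ∣ B_k` implies `p ∣ k` (`dvd_of_div_bernoulli_mem_pIntegral`), so `C(k,2)`
supplies the missing `p`. An elementary evaluation of `S_k(p)` modulo `p^2`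
(`pow_sub_one_mul_sum_pow`) plays the role of Kummer's congruence here. -/

/-- The ring of rational numbers whose denominator is prime to `p`. -/
def pIntegral (p : ℕ) [Fact p.Prime] : Subring ℚ := (Rat.padicValuation p).integer

/-! ### Arithmetic of `p`-integral rationals -/

section pIntegral

variable {p : ℕ} [Fact p.Prime]

theorem mem_pIntegral {x : ℚ} : x ∈ pIntegral p ↔ ¬ p ∣ x.den :=
  Rat.padicValuation_le_one_iff

theorem inv_natCast_mem_pIntegral {n : ℕ} (hn : ¬ p ∣ n) : (n : ℚ)⁻¹ ∈ pIntegral p := by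
  rw [mem_pIntegral, Rat.inv_natCast_den_of_pos]
  · exact hn
  · rcases Nat.eq_zero_or_pos n with rfl | h
    · exact absurd (dvd_zero p) hn
    · exact h

theorem inv_prime_notMem_pIntegral : ((p : ℚ)⁻¹) ∉ pIntegral p := by
  rw [mem_pIntegral, Rat.inv_natCast_den_of_pos (Fact.out : p.Prime).pos]
  simp

theorem prime_pow_div_mem_pIntegral {M a : ℕ} (hM : M ≠ 0) (hv : M.factorization p ≤ a) :
    (p : ℚ) ^ a / M ∈ pIntegral p := by
  have hp : p.Prime := Fact.out
  have hp0 : (p : ℚ) ≠ 0 := mod_cast hp.ne_zero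
  have hdecomp : p ^ M.factorization p * (M / p ^ M.factorization p) = M :=
    Nat.ordProj_mul_ordCompl_eq_self M p
  have hnd : ¬ p ∣ M / p ^ M.factorization p := Nat.not_dvd_ordCompl hp hM
  generalize M / p ^ M.factorization p = M' at hdecomp hnd
  obtain ⟨b, hb⟩ := Nat.exists_eq_add_of_le hv
  generalize M.factorization p = e at *
  subst hdecomp
  have : (p : ℚ) ^ a / ((p ^ e * M' : ℕ) : ℚ) = (p : ℚ) ^ b * (M' : ℚ)⁻¹ := by
    rw [hb, pow_add]
    push_cast
    rw [mul_div_mul_left _ _ (pow_ne_zero e hp0), div_eq_mul_inv]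
  rw [this]
  exact mul_mem (pow_mem (natCast_mem _ _) _) (inv_natCast_mem_pIntegral hnd)

theorem pow_div_mem_pIntegral {m M a : ℕ} (hpm : p ∣ m) (hM : M ≠ 0)
    (hv : M.factorization p ≤ a) : (m : ℚ) ^ a / M ∈ pIntegral p := by
  obtain ⟨c, rfl⟩ := hpm
  have : ((p * c : ℕ) : ℚ) ^ a / M = (c : ℚ) ^ a * ((p : ℚ) ^ a / M) := by
    push_cast; ring
  rw [this]
  exact mul_mem (pow_mem (natCast_mem _ _) _) (prime_pow_div_mem_pIntegral hM hv)

theorem pow_dvd_of_div_mem_pIntegral {n : ℤ} {s : ℕ} (h : (n : ℚ) / (p : ℚ) ^ s ∈ pIntegral p) :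
    (p : ℤ) ^ s ∣ n := by
  have hp : p.Prime := Fact.out
  have hp0 : (p : ℚ) ≠ 0 := mod_cast hp.ne_zero
  rw [mem_pIntegral] at h
  set x : ℚ := (n : ℚ) / (p : ℚ) ^ s with hx
  have h1 : (n : ℚ) = x * (p : ℚ) ^ s := by rw [hx]; field_simp
  have h2 : (n : ℚ) * x.den = x.num * (p : ℚ) ^ s := by
    rw [h1, ← Rat.mul_den_eq_num x]; ring
  have h3 : n * x.den = x.num * (p : ℤ) ^ s := by exact_mod_cast h2
  have hcop : IsCoprime ((p : ℤ) ^ s) (x.den : ℤ) :=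
    (Nat.isCoprime_iff_coprime.mpr ((Nat.Prime.coprime_iff_not_dvd hp).mpr h)).pow_left
  exact hcop.dvd_of_dvd_mul_right (h3 ▸ dvd_mul_left _ _)

/-! ### Integrality properties of Bernoulli numbers -/

theorem sum_inv_prime_mem_pIntegral (s : Finset ℕ) (hs : ∀ q ∈ s, q.Prime ∧ q ≠ p) :
    ∑ q ∈ s, (1 : ℚ) / q ∈ pIntegral p := by
  refine sum_mem fun q hq ↦ ?_
  rw [one_div]
  exact inv_natCast_mem_pIntegral fun h ↦
    (hs q hq).2 ((Nat.prime_dvd_prime_iff_eq Fact.out (hs q hq).1).mp h).symm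

theorem bernoulli_mem_pIntegral {n : ℕ} (hn : Even n) (h : ¬ (p - 1) ∣ n) :
    bernoulli n ∈ pIntegral p := by
  obtain ⟨k, rfl⟩ := hn.exists_two_nsmul
  rw [smul_eq_mul] at *
  obtain ⟨T, hT⟩ := Bernoulli.vonStaudt_clausen k
  rw [eq_sub_of_add_eq hT.symm]
  refine sub_mem (intCast_mem _ _) (sum_inv_prime_mem_pIntegral _ fun q hq ↦ ?_)
  rw [Finset.mem_filter] at hq
  refine ⟨hq.2.1, ?_⟩
  rintro rfl
  exact h hq.2.2

theorem exists_bernoulli_eq_sub_inv {n : ℕ} (hn : Even n) (hn0 : n ≠ 0) (h : (p - 1) ∣ n) :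
    ∃ x ∈ pIntegral p, bernoulli n = x - (p : ℚ)⁻¹ := by
  obtain ⟨k, rfl⟩ := hn.exists_two_nsmul
  rw [smul_eq_mul] at *
  obtain ⟨T, hT⟩ := Bernoulli.vonStaudt_clausen k
  have hmem : p ∈ (Finset.range (2 * k + 2)).filter fun q ↦ q.Prime ∧ (q - 1) ∣ 2 * k := by
    rw [Finset.mem_filter, Finset.mem_range]
    refine ⟨?_, Fact.out, h⟩
    have := Nat.le_of_dvd (by lia) h
    lia
  rw [← Finset.add_sum_erase _ _ hmem] at hT
  refine ⟨_, sub_mem (intCast_mem _ T) (sum_inv_prime_mem_pIntegral _ fun q hq ↦ ?_),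
    by rw [hT, one_div]; ring⟩
  rw [Finset.mem_erase, Finset.mem_filter] at hq
  exact ⟨hq.2.2.1, hq.1⟩

theorem bernoulli_notMem_pIntegral {n : ℕ} (hn : Even n) (hn0 : n ≠ 0) (h : (p - 1) ∣ n) :
    bernoulli n ∉ pIntegral p := by
  obtain ⟨x, hx, hB⟩ := exists_bernoulli_eq_sub_inv (p := p) hn hn0 h
  intro hmem
  refine inv_prime_notMem_pIntegral (p := p) ?_
  rw [show (p : ℚ)⁻¹ = x - bernoulli n by rw [hB]; ring]
  exact sub_mem hx hmem

theorem prime_mul_bernoulli_mem_pIntegral {n : ℕ} (hn : Even n) :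
    (p : ℚ) * bernoulli n ∈ pIntegral p := by
  by_cases hn0 : n = 0
  · subst hn0
    rw [bernoulli_zero, mul_one]
    exact natCast_mem _ _
  by_cases h : (p - 1) ∣ n
  · obtain ⟨x, hx, hB⟩ := exists_bernoulli_eq_sub_inv (p := p) hn hn0 h
    have hp0 : (p : ℚ) ≠ 0 := mod_cast (Fact.out : p.Prime).ne_zero
    rw [hB, mul_sub, mul_inv_cancel₀ hp0]
    exact sub_mem (mul_mem (natCast_mem _ _) hx) (one_mem _)
  · exact mul_mem (natCast_mem _ _) (bernoulli_mem_pIntegral hn h)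

theorem mul_bernoulli_mem_pIntegral {m n : ℕ} (hpm : p ∣ m) (hn : Even n) :
    (m : ℚ) * bernoulli n ∈ pIntegral p := by
  obtain ⟨c, rfl⟩ := hpm
  rw [show ((p * c : ℕ) : ℚ) * bernoulli n = c * (p * bernoulli n) by push_cast; ring]
  exact mul_mem (natCast_mem _ _) (prime_mul_bernoulli_mem_pIntegral hn)

/-- For `p = 2, 3` the number `p - 1` divides every even `n`, so `p` divides the denominator. -/
theorem five_le_of_bernoulli_mem_pIntegral {n : ℕ} (hn : Even n) (hn0 : n ≠ 0)
    (h : bernoulli n ∈ pIntegral p) : 5 ≤ p := by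
  have hp : p.Prime := Fact.out
  have h2 := hp.two_le
  have hnd : ¬ (p - 1) ∣ n := fun hd ↦ bernoulli_notMem_pIntegral hn hn0 hd h
  by_contra! hlt
  interval_cases p
  · exact hnd (one_dvd _)
  · exact hnd hn.two_dvd
  · exact absurd hp (by decide)

end pIntegral

/-! ### Faulhaber's formula -/

/-- Replacing `C(k+1,i)/(k+1)` by `C(k,i)/(k+1-i)` makes each denominator depend only on the
exponent of `m` beside it. -/
theorem powerSum_sub_bernoulli_mul {k : ℕ} (hk : 0 < k) (m : ℕ) :
    (powerSum k m : ℚ) - bernoulli k * m =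
      ∑ i ∈ Finset.range k,
        bernoulli i * (k.choose i : ℚ) * (m : ℚ) ^ (k + 1 - i) / ((k + 1 - i : ℕ) : ℚ) := by
  have h0 : (powerSum k m : ℚ) = ∑ j ∈ Finset.range m, (j : ℚ) ^ k := by
    rw [powerSum]
    push_cast
    cases m with
    | zero => simp
    | succ m => rw [Finset.sum_range_eq_add_Ico _ (by lia)]; simp [hk.ne']
  rw [h0, sum_range_pow, Finset.sum_range_succ, Nat.choose_succ_self_right,
    Nat.add_sub_cancel_left]
  have hk1 : ((k : ℚ) + 1) ≠ 0 := by positivity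
  rw [show bernoulli k * ((k + 1 : ℕ) : ℚ) * (m : ℚ) ^ 1 / (k + 1) = bernoulli k * m by
    push_cast; field_simp, add_sub_cancel_right]
  refine Finset.sum_congr rfl fun i hi ↦ ?_
  have hi := Finset.mem_range.mp hi
  have hne : ((k + 1 - i : ℕ) : ℚ) ≠ 0 := by
    rw [Nat.cast_ne_zero]; lia
  have hch : (k.choose i : ℚ) * (k + 1) = ((k + 1).choose i : ℚ) * ((k + 1 - i : ℕ) : ℚ) := by
    exact_mod_cast Nat.choose_mul_succ_eq k i
  rw [div_eq_div_iff hk1 hne]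
  linear_combination (- bernoulli i * (m : ℚ) ^ (k + 1 - i)) * hch

/-! ### Termwise `p`-adic bounds: one and two powers of `m` -/

section Local

variable {p : ℕ} [Fact p.Prime]

/-- A term-by-term criterion for the integrality of `(S_k(m) - B_k m) / m ^ s`. -/
theorem powerSum_sub_div_mem_pIntegral {k m s : ℕ} (hk : 0 < k) (hke : Even k) (hm : m ≠ 0)
    (hsk : s ≤ k) (hone : (m : ℚ) ^ (k - s) / 2 ∈ pIntegral p)
    (hs : s ≤ 3)
    (hterm : ∀ i d : ℕ, k = i + d → Even i → Even d → 2 ≤ d →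
      bernoulli i * (k.choose i : ℚ) * ((m : ℚ) ^ (d + 1 - s) / ((d + 1 : ℕ) : ℚ)) ∈
        pIntegral p) :
    ((powerSum k m : ℚ) - bernoulli k * m) / (m : ℚ) ^ s ∈ pIntegral p := by
  have hm0 : (m : ℚ) ≠ 0 := mod_cast hm
  rw [powerSum_sub_bernoulli_mul hk, Finset.sum_div]
  refine sum_mem fun i hi ↦ ?_
  obtain ⟨d, rfl⟩ := Nat.exists_eq_add_of_le (Finset.mem_range.mp hi).le
  have hi := Finset.mem_range.mp hi
  rw [show i + d + 1 - i = d + 1 by lia]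
  have key : s ≤ d + 1 → bernoulli i * ((i + d).choose i : ℚ) * (m : ℚ) ^ (d + 1) /
      ((d + 1 : ℕ) : ℚ) / (m : ℚ) ^ s =
      bernoulli i * ((i + d).choose i : ℚ) * ((m : ℚ) ^ (d + 1 - s) / ((d + 1 : ℕ) : ℚ)) := by
    intro h
    rw [pow_sub₀ _ hm0 h]
    field_simp
  rcases Nat.even_or_odd i with hie | hio
  · have hde : Even d := (Nat.even_add.mp hke).mp hie
    have hd2 : 2 ≤ d := by
      obtain ⟨c, rfl⟩ := hde
      lia
    rw [key (by lia)]
    exact hterm i d rfl hie hde hd2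
  -- Among odd indices only `B_1 = -1/2` is nonzero; its term is `-m^k/2`.
  · by_cases hi1 : i = 1
    · subst hi1
      rw [key (by lia)]
      have : bernoulli 1 * ((1 + d).choose 1 : ℚ) *
          ((m : ℚ) ^ (d + 1 - s) / ((d + 1 : ℕ) : ℚ)) = -((m : ℚ) ^ (1 + d - s) / 2) := by
        rw [bernoulli_one, Nat.choose_one_right, add_comm 1 d]
        have : ((d + 1 : ℕ) : ℚ) ≠ 0 := by positivity
        field_simp
      rw [this]
      exact neg_mem hone
    · rw [bernoulli_eq_zero_of_odd hio (by have := hio.pos; lia)]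
      simp

theorem bernoulli_term_mem_pIntegral {m i d a : ℕ} (c : ℕ) (hpm : p ∣ m) (hi : Even i)
    (hv : (d + 1).factorization p ≤ a) :
    bernoulli i * (c : ℚ) * ((m : ℚ) ^ (a + 1) / ((d + 1 : ℕ) : ℚ)) ∈ pIntegral p := by
  rw [show bernoulli i * (c : ℚ) * ((m : ℚ) ^ (a + 1) / ((d + 1 : ℕ) : ℚ)) =
    (m * bernoulli i) * c * ((m : ℚ) ^ a / ((d + 1 : ℕ) : ℚ)) by ring]
  exact mul_mem (mul_mem (mul_bernoulli_mem_pIntegral hpm hi) (natCast_mem _ _))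
    (pow_div_mem_pIntegral hpm (by lia) hv)

theorem pow_div_two_mem_pIntegral (hp : 5 ≤ p) (m a : ℕ) : (m : ℚ) ^ a / 2 ∈ pIntegral p := by
  rw [div_eq_mul_inv]
  refine mul_mem (pow_mem (natCast_mem _ _) _) ?_
  exact_mod_cast inv_natCast_mem_pIntegral (p := p) (n := 2)
    fun h ↦ by have := Nat.le_of_dvd (by lia) h; lia

theorem factorization_add_three_le {q : ℕ} (hq : 2 ≤ q) (a : ℕ) (h : q ≠ 2 ∨ a ≠ 0) :
    (a + 3).factorization q ≤ a + 1 := by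
  rcases Nat.eq_zero_or_pos a with rfl | ha
  · refine Nat.factorization_le_of_le_pow ?_
    simp at h ⊢
    lia
  · refine Nat.factorization_le_of_le_pow ?_
    calc a + 3 ≤ 2 ^ (a + 1) := by
          induction a, ha using Nat.le_induction with
          | base => norm_num
          | succ b hb ih => rw [pow_succ]; have := ih (by lia); lia
      _ ≤ q ^ (a + 1) := Nat.pow_le_pow_left hq _

theorem add_five_le_five_pow (a : ℕ) : a + 5 ≤ 5 ^ (a + 1) := by
  induction a with
  | zero => norm_num
  | succ b ih => rw [pow_succ]; lia

theorem powerSum_sub_div_self_mem_pIntegral {k m : ℕ} (hk : 2 ≤ k) (hke : Even k) (hm : m ≠ 0)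
    (hpm : p ∣ m) : ((powerSum k m : ℚ) - bernoulli k * m) / m ∈ pIntegral p := by
  have hp : p.Prime := Fact.out
  have := powerSum_sub_div_mem_pIntegral (p := p) (s := 1) (by lia) hke hm (by lia) ?_ (by lia) ?_
  · simpa using this
  · refine mod_cast pow_div_mem_pIntegral hpm two_ne_zero ?_
    refine Nat.factorization_le_of_le_pow (hp.two_le.trans ?_)
    exact Nat.le_self_pow (by lia) p
  · intro i d hkd hi hd hd2
    obtain ⟨a, rfl⟩ := Nat.exists_eq_add_of_le' hd2
    rw [show a + 2 + 1 - 1 = (a + 1) + 1 by lia]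
    refine bernoulli_term_mem_pIntegral _ hpm hi ?_
    -- The size bound fails only for `p = 2`, `d = 2`, where `d + 1 = 3` is odd.
    by_cases h : p ≠ 2 ∨ a ≠ 0
    · exact factorization_add_three_le hp.two_le a h
    · push Not at h
      obtain ⟨rfl, rfl⟩ := h
      rw [Nat.factorization_eq_zero_of_not_dvd (by decide)]
      lia

theorem powerSum_sub_div_sq_mem_pIntegral {k m : ℕ} (hk : 2 ≤ k) (hke : Even k) (hm : m ≠ 0)
    (hpm : p ∣ m) (hB : bernoulli k ∈ pIntegral p) :
    ((powerSum k m : ℚ) - bernoulli k * m) / (m : ℚ) ^ 2 ∈ pIntegral p := by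
  have hp5 : 5 ≤ p := five_le_of_bernoulli_mem_pIntegral hke (by lia) hB
  refine powerSum_sub_div_mem_pIntegral (by lia) hke hm hk (pow_div_two_mem_pIntegral hp5 _ _)
    (by lia) fun i d hkd hi hd hd2 ↦ ?_
  obtain ⟨a, rfl⟩ := Nat.exists_eq_add_of_le' hd2
  rw [show a + 2 + 1 - 2 = a + 1 by lia]
  refine bernoulli_term_mem_pIntegral _ hpm hi ?_
  rcases a with _ | a
  · rw [Nat.factorization_eq_zero_of_lt (by lia)]
  · refine Nat.factorization_le_of_le_pow ?_
    calc a + 1 + 2 + 1 ≤ 5 ^ (a + 1) := by have := add_five_le_five_pow a; lia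
      _ ≤ p ^ (a + 1) := Nat.pow_le_pow_left hp5 _

end Local

/-! ### Power sums modulo the square of a prime -/

theorem sub_pow_of_sq_eq_zero {R : Type*} [CommRing R] {P : R} (hP : P ^ 2 = 0) (x : R) (n : ℕ) :
    (x - P) ^ (n + 1) = x ^ (n + 1) - (n + 1) * P * x ^ n := by
  induction n with
  | zero => simp
  | succ n ih =>
    rw [pow_succ, ih]
    push_cast
    linear_combination (n + 1) * x ^ n * hP

theorem sum_range_two_mul_add_one_reflect {M : Type*} [AddCommMonoid M] (f : ℕ → M) (h : ℕ) :
    ∑ j ∈ Finset.range (2 * h + 1), f j =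
      f 0 + (∑ i ∈ Finset.range h, f (i + 1) + ∑ i ∈ Finset.range h, f (2 * h + 1 - (i + 1))) := by
  rw [show 2 * h + 1 = h + h + 1 by lia, Finset.sum_range_succ', add_comm,
    Finset.sum_range_add (fun j ↦ f (j + 1)), ← Finset.sum_range_reflect (fun j ↦ f (h + j + 1))]
  congr 2
  refine Finset.sum_congr rfl fun i hi ↦ ?_
  have := Finset.mem_range.mp hi
  congr 1
  lia

theorem sum_range_two_mul_add_one_parity {M : Type*} [AddCommMonoid M] (f : ℕ → M) (h : ℕ) :
    ∑ j ∈ Finset.range (2 * h + 1), f j =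
      f 0 + (∑ i ∈ Finset.range h, f (2 * (i + 1)) +
        ∑ i ∈ Finset.range h, f (2 * h + 1 - 2 * (i + 1))) := by
  have h1 : ∑ j ∈ Finset.range (2 * h + 1), f j =
      f 0 + (∑ i ∈ Finset.range h, f (2 * (i + 1)) + ∑ i ∈ Finset.range h, f (2 * i + 1)) := by
    induction h with
    | zero => simp
    | succ h ih =>
      rw [show 2 * (h + 1) + 1 = 2 * h + 1 + 1 + 1 by lia, Finset.sum_range_succ,
        Finset.sum_range_succ, ih, Finset.sum_range_succ, Finset.sum_range_succ,
        show 2 * (h + 1) = 2 * h + 1 + 1 by lia]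
      abel
  rw [h1, ← Finset.sum_range_reflect (fun i ↦ f (2 * i + 1))]
  congr 2
  refine Finset.sum_congr rfl fun i hi ↦ ?_
  have := Finset.mem_range.mp hi
  congr 1
  lia

/-- With `P = 2h + 1`, split the sum in two ways: into pairs `j, P - j`, and into evens `2j` and
odds `P - 2j`. Expanding to first order in `P` and eliminating the half sum of `(n+1)`-th powers
leaves the identity. -/
theorem pow_sub_one_mul_sum_pow {R : Type*} [CommRing R] {n h : ℕ} (hn : Odd n)
    (hP : ((2 * h + 1 : ℕ) : R) ^ 2 = 0) :
    (2 ^ (n + 1) - 1) * ∑ j ∈ Finset.range (2 * h + 1), (j : R) ^ (n + 1) =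
      -(2 ^ n * (n + 1) * ((2 * h + 1 : ℕ) : R) *
        ∑ i ∈ Finset.range h, ((i + 1 : ℕ) : R) ^ n) := by
  have hrefl : ∀ x : ℕ, x ≤ 2 * h + 1 → ((2 * h + 1 - x : ℕ) : R) ^ (n + 1) =
      (x : R) ^ (n + 1) - (n + 1) * ((2 * h + 1 : ℕ) : R) * (x : R) ^ n := by
    intro x hx
    rw [Nat.cast_sub hx, ← neg_sub, hn.add_one.neg_pow, sub_pow_of_sq_eq_zero hP]
  have h1 := sum_range_two_mul_add_one_reflect (fun j ↦ (j : R) ^ (n + 1)) h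
  have h2 := sum_range_two_mul_add_one_parity (fun j ↦ (j : R) ^ (n + 1)) h
  have e1 : ∑ i ∈ Finset.range h, ((2 * h + 1 - (i + 1) : ℕ) : R) ^ (n + 1) =
      ∑ i ∈ Finset.range h, ((i + 1 : ℕ) : R) ^ (n + 1) -
        (n + 1) * ((2 * h + 1 : ℕ) : R) * ∑ i ∈ Finset.range h, ((i + 1 : ℕ) : R) ^ n := by
    rw [Finset.mul_sum, ← Finset.sum_sub_distrib]
    refine Finset.sum_congr rfl fun i hi ↦ hrefl _ ?_
    have := Finset.mem_range.mp hi
    lia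
  have e2 : ∑ i ∈ Finset.range h, ((2 * h + 1 - 2 * (i + 1) : ℕ) : R) ^ (n + 1) =
      2 ^ (n + 1) * ∑ i ∈ Finset.range h, ((i + 1 : ℕ) : R) ^ (n + 1) -
        (n + 1) * ((2 * h + 1 : ℕ) : R) *
          (2 ^ n * ∑ i ∈ Finset.range h, ((i + 1 : ℕ) : R) ^ n) := by
    rw [Finset.mul_sum, Finset.mul_sum, Finset.mul_sum, ← Finset.sum_sub_distrib]
    refine Finset.sum_congr rfl fun i hi ↦ ?_
    have := Finset.mem_range.mp hi
    rw [hrefl _ (by lia), Nat.cast_mul, Nat.cast_two, mul_pow, mul_pow]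
  have e3 : ∑ i ∈ Finset.range h, ((2 * (i + 1) : ℕ) : R) ^ (n + 1) =
      2 ^ (n + 1) * ∑ i ∈ Finset.range h, ((i + 1 : ℕ) : R) ^ (n + 1) := by
    rw [Finset.mul_sum]
    exact Finset.sum_congr rfl fun i _ ↦ by rw [Nat.cast_mul, Nat.cast_two, mul_pow]
  simp only [Nat.cast_zero, zero_pow (Nat.succ_ne_zero n), zero_add] at h1 h2
  rw [e1] at h1
  rw [e2, e3] at h2
  linear_combination 2 ^ (n + 1) * h1 - h2

/-! ### The exceptional term and three powers of `m` -/

section Local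

variable {p : ℕ} [Fact p.Prime]

/-- By Fermat the sum is `h(h+1)/2` modulo `p`, and `0 < h < h + 1 < p`. -/
theorem not_dvd_sum_pow_of_dvd {h n : ℕ} (hp : p = 2 * h + 1) (hh : 1 ≤ h) (hn : (p - 1) ∣ n) :
    ¬ p ∣ ∑ i ∈ Finset.range h, (i + 1) ^ (n + 1) := by
  intro hd
  have h1 : ((∑ i ∈ Finset.range h, (i + 1) ^ (n + 1) : ℕ) : ZMod p) =
      ((∑ i ∈ Finset.range h, (i + 1) : ℕ) : ZMod p) := by
    push_cast
    refine Finset.sum_congr rfl fun i hi ↦ ?_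
    have hi := Finset.mem_range.mp hi
    obtain ⟨c, rfl⟩ := hn
    have hne : ((i : ZMod p) + 1) ≠ 0 := by
      intro h0
      have : ((i + 1 : ℕ) : ZMod p) = 0 := by exact_mod_cast h0
      rw [ZMod.natCast_eq_zero_iff] at this
      have := Nat.le_of_dvd (by lia) this
      lia
    rw [pow_succ, pow_mul, ZMod.pow_card_sub_one_eq_one hne, one_pow, one_mul]
  rw [(ZMod.natCast_eq_zero_iff _ _).mpr hd] at h1
  have h2 := (ZMod.natCast_eq_zero_iff _ _).mp h1.symm
  have h3 : (∑ i ∈ Finset.range h, (i + 1)) * 2 = (h + 1) * h := by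
    have := Finset.sum_range_id_mul_two (h + 1)
    rwa [Finset.sum_range_succ', add_zero, Nat.add_sub_cancel] at this
  have h4 : p ∣ (h + 1) * h := h3 ▸ h2.mul_right 2
  rcases (Nat.Prime.dvd_mul Fact.out).mp h4 with h5 | h5
  · have := Nat.le_of_dvd (by lia) h5; lia
  · have := Nat.le_of_dvd (by lia) h5; lia

/-- If `p ∣ B_k` and `k ≡ 2 (mod p - 1)`, then `p ∣ k`. -/
theorem dvd_of_div_bernoulli_mem_pIntegral {k : ℕ} (hk : 2 ≤ k) (hke : Even k)
    (hB : bernoulli k / p ∈ pIntegral p) (hd : (p - 1) ∣ k - 2) : p ∣ k := by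
  have hp : p.Prime := Fact.out
  have hp0 : (p : ℚ) ≠ 0 := mod_cast hp.ne_zero
  have hB' : bernoulli k ∈ pIntegral p := by
    rw [show bernoulli k = p * (bernoulli k / p) by field_simp]
    exact mul_mem (natCast_mem _ _) hB
  have hp5 : 5 ≤ p := five_le_of_bernoulli_mem_pIntegral hke (by lia) hB'
  -- The congruence modulo `m^2` at `m = p`, combined with `p ∣ B_k`, gives `p^2 ∣ S_k(p)`.
  have hS : (((powerSum k p : ℕ) : ℤ) : ℚ) / (p : ℚ) ^ 2 ∈ pIntegral p := by
    have := add_mem (powerSum_sub_div_sq_mem_pIntegral hk hke hp.ne_zero dvd_rfl hB') hB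
    convert this using 1
    push_cast
    field_simp
    ring
  have hS2 : p ^ 2 ∣ powerSum k p := by exact_mod_cast pow_dvd_of_div_mem_pIntegral hS
  obtain ⟨h, hh⟩ : ∃ h, p = 2 * h + 1 := hp.odd_of_ne_two (by lia)
  obtain ⟨n, rfl⟩ := Nat.exists_eq_add_of_le' hk
  rw [Nat.add_sub_cancel] at hd
  have hn : Odd (n + 1) := Nat.not_even_iff_odd.mp fun h ↦ Nat.not_even_iff_odd.mpr h.add_one hke
  have hP : ((2 * h + 1 : ℕ) : ZMod (p ^ 2)) ^ 2 = 0 := by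
    rw [← hh, ← Nat.cast_pow]
    exact ZMod.natCast_self _
  have key := pow_sub_one_mul_sum_pow hn hP
  have hsum : ∑ j ∈ Finset.range (2 * h + 1), (j : ZMod (p ^ 2)) ^ (n + 1 + 1) = 0 := by
    rw [← (ZMod.natCast_eq_zero_iff _ _).mpr hS2, powerSum, ← hh,
      Finset.sum_range_eq_add_Ico _ hp.pos]
    simp
  rw [hsum, mul_zero, zero_eq_neg, ← hh] at key
  have key' : ((2 ^ (n + 1) * (n + 2) * p * ∑ i ∈ Finset.range h, (i + 1) ^ (n + 1) : ℕ) :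
      ZMod (p ^ 2)) = 0 := by
    rw [← key]
    push_cast
    ring
  rw [ZMod.natCast_eq_zero_iff, sq, mul_right_comm] at key'
  have h3 := Nat.dvd_of_mul_dvd_mul_right hp.pos key'
  rcases (Nat.Prime.dvd_mul hp).mp h3 with h4 | h4
  · rcases (Nat.Prime.dvd_mul hp).mp h4 with h5 | h5
    · have := Nat.le_of_dvd (by lia) (hp.dvd_of_dvd_pow h5)
      lia
    · exact h5
  · exact absurd h4 (not_dvd_sum_pow_of_dvd hh (by lia) hd)

theorem powerSum_sub_div_cube_mem_pIntegral {k m : ℕ} (hk : 4 ≤ k) (hke : Even k) (hm : m ≠ 0)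
    (hpm : p ∣ m) (hB : bernoulli k / p ∈ pIntegral p) :
    ((powerSum k m : ℚ) - bernoulli k * m) / (m : ℚ) ^ 3 ∈ pIntegral p := by
  have hp : p.Prime := Fact.out
  have hp0 : (p : ℚ) ≠ 0 := mod_cast hp.ne_zero
  have hB' : bernoulli k ∈ pIntegral p := by
    rw [show bernoulli k = p * (bernoulli k / p) by field_simp]
    exact mul_mem (natCast_mem _ _) hB
  have hp5 : 5 ≤ p := five_le_of_bernoulli_mem_pIntegral hke (by lia) hB'
  refine powerSum_sub_div_mem_pIntegral (by lia) hke hm (by lia) (pow_div_two_mem_pIntegral hp5 _ _)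
    (by lia) fun i d hkd hi hd hd2 ↦ ?_
  obtain ⟨a, rfl⟩ := Nat.exists_eq_add_of_le' hd2
  rcases a with _ | _ | a
  · have h3 : ((0 + 2 + 1 : ℕ) : ℚ)⁻¹ ∈ pIntegral p :=
      inv_natCast_mem_pIntegral fun h ↦ by have := Nat.le_of_dvd (by lia) h; lia
    rw [show 0 + 2 + 1 - 3 = 0 by lia, pow_zero, one_div]
    refine mul_mem ?_ h3
    -- Here `i = k - 2`. If `B_i` has a pole at `p`, the factor `k` of `C(k,2)` cancels it.
    by_cases hdi : (p - 1) ∣ i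
    · obtain ⟨c, hc⟩ := dvd_of_div_bernoulli_mem_pIntegral (by lia) hke hB
        (by rwa [hkd, zero_add, Nat.add_sub_cancel])
      have hch : (k.choose i : ℚ) = k * (k - 1) / 2 := by
        rw [← Nat.cast_choose_two, hkd, zero_add, Nat.choose_symm_add]
      have hk1 : (k : ℚ) - 1 ∈ pIntegral p := sub_mem (natCast_mem _ _) (one_mem _)
      have h2 : ((2 : ℕ) : ℚ)⁻¹ ∈ pIntegral p :=
        inv_natCast_mem_pIntegral fun h ↦ by have := Nat.le_of_dvd (by lia) h; lia
      have : bernoulli i * (k.choose i : ℚ) =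
          (p * bernoulli i) * c * (k - 1) * ((2 : ℕ) : ℚ)⁻¹ := by
        rw [hch]
        nth_rewrite 1 [hc]
        push_cast
        ring
      rw [this]
      exact mul_mem (mul_mem (mul_mem (prime_mul_bernoulli_mem_pIntegral hi)
        (natCast_mem _ _)) hk1) h2
    · exact mul_mem (bernoulli_mem_pIntegral hi hdi) (natCast_mem _ _)
  · rw [Nat.even_iff] at hd
    lia
  · rw [show a + 1 + 1 + 2 + 1 - 3 = (a + 1) + 1 by lia]
    refine bernoulli_term_mem_pIntegral _ hpm hi (Nat.factorization_le_of_le_pow ?_)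
    calc a + 1 + 1 + 2 + 1 ≤ 5 ^ (a + 1) := by have := add_five_le_five_pow a; lia
      _ ≤ p ^ (a + 1) := Nat.pow_le_pow_left hp5 _

theorem bernoulli_div_mem_pIntegral {k : ℕ} (h : (p : ℤ) ∣ bernoulliNum k) :
    bernoulli k / p ∈ pIntegral p := by
  have hp : p.Prime := Fact.out
  have hp0 : (p : ℚ) ≠ 0 := mod_cast hp.ne_zero
  obtain ⟨c, hc⟩ := h
  have hden : ¬ p ∣ (bernoulli k).den := fun hd ↦ by
    have h1 : p ∣ (bernoulli k).num.natAbs := Int.natCast_dvd.mp ⟨c, hc⟩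
    exact Nat.not_coprime_of_dvd_of_dvd hp.one_lt h1 hd (bernoulli k).reduced
  have : bernoulli k / p = c * ((bernoulli k).den : ℚ)⁻¹ := by
    nth_rewrite 1 [← Rat.num_div_den (bernoulli k)]
    rw [show (bernoulli k).num = p * c from hc]
    push_cast
    field_simp
  rw [this]
  exact mul_mem (intCast_mem _ _) (inv_natCast_mem_pIntegral hden)

end Local

/-! ### From local to global congruences -/

theorem ratModEq_of_forall_mem_pIntegral {n : ℕ} {x y : ℚ} (hn : n ≠ 0)
    (h : ∀ (p : ℕ) [Fact p.Prime], p ∣ n → (x - y) / n ∈ pIntegral p) : RatModEq n x y := by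
  have hn0 : (n : ℚ) ≠ 0 := mod_cast hn
  refine ⟨((x - y) / n).num, ((x - y) / n).den, mod_cast ((x - y) / n).den_nz, ?_, ?_⟩
  · refine Nat.isCoprime_iff_coprime.mpr (Nat.coprime_of_dvd fun p hp hpd hpn ↦ ?_)
    have := Fact.mk hp
    exact mem_pIntegral.mp (h p hpn) hpd
  · rw [Int.cast_natCast, Rat.num_div_den]
    field_simp

theorem ratModEq_pow_of_forall_mem_pIntegral {m s : ℕ} {x y : ℚ} (hm : m ≠ 0)
    (h : ∀ (p : ℕ) [Fact p.Prime], p ∣ m → (x - y) / (m : ℚ) ^ s ∈ pIntegral p) :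
    RatModEq (m ^ s) x y := by
  refine ratModEq_of_forall_mem_pIntegral (pow_ne_zero s hm) fun p _ hp ↦ ?_
  rw [Nat.cast_pow]
  exact h p ((Fact.out : p.Prime).dvd_of_dvd_pow hp)

/-- Since `p^r ∣ m`, integrality of the quotient by `m^s` passes to the quotient by `p^(s r)`; for
`r = 0` the modulus is 1 and no prime divides it. -/
theorem ratModEq_prime_pow_of_mem_pIntegral {p r m s : ℕ} [Fact p.Prime] {x y : ℚ} (hm : m ≠ 0)
    (hr : p ^ r ∣ m) (h : p ∣ m → (x - y) / (m : ℚ) ^ s ∈ pIntegral p) :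
    RatModEq (p ^ (s * r)) x y := by
  have hp : p.Prime := Fact.out
  refine ratModEq_of_forall_mem_pIntegral (pow_ne_zero _ hp.ne_zero) fun q _ hq ↦ ?_
  obtain rfl : q = p := (Nat.prime_dvd_prime_iff_eq Fact.out hp).mp
    ((Fact.out : q.Prime).dvd_of_dvd_pow hq)
  have hr0 : r ≠ 0 := by
    rintro rfl
    simp only [mul_zero, pow_zero, Nat.dvd_one] at hq
    exact hp.one_lt.ne' hq
  obtain ⟨c, rfl⟩ := hr
  have hq0 : (q : ℚ) ≠ 0 := mod_cast hp.ne_zero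
  have hc0 : (c : ℚ) ≠ 0 := by
    rintro h0
    exact hm (by rw [Nat.cast_eq_zero.mp h0, mul_zero])
  have : (x - y) / ((q ^ (s * r) : ℕ) : ℚ) =
      (c : ℚ) ^ s * ((x - y) / ((q ^ r * c : ℕ) : ℚ) ^ s) := by
    push_cast
    rw [mul_pow, ← pow_mul, mul_comm r s]
    field_simp
  rw [this]
  exact mul_mem (pow_mem (natCast_mem _ _) _) (h ((dvd_pow_self q hr0).mul_right c))

theorem mainTheorem4 (k m : ℕ) (hk : 0 < k) (hm : 0 < m) (hke : Even k) :
    (2 ≤ k → RatModEq m (powerSum k m) (bernoulli k * m)) ∧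
    (4 ≤ k → Nat.gcd (bernoulliDen k) m = 1 →
      RatModEq (m ^ 2) (powerSum k m) (bernoulli k * m)) ∧
    (6 ≤ k → (m : ℤ) ∣ bernoulliNum k →
      RatModEq (m ^ 3) (powerSum k m) (bernoulli k * m)) ∧
    (∀ p r : ℕ, p.Prime → p ^ r ∣ m → ¬ p ^ (r + 1) ∣ m →
      (4 ≤ k → ¬ p ∣ bernoulliDen k →
        RatModEq (p ^ (2 * r)) (powerSum k m) (bernoulli k * m)) ∧
      (6 ≤ k → (p : ℤ) ∣ bernoulliNum k →
        RatModEq (p ^ (3 * r)) (powerSum k m) (bernoulli k * m))) := by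
  refine ⟨fun hk2 ↦ ?_, fun hk4 hgcd ↦ ?_, fun hk6 hdvd ↦ ?_, fun p r hp hpr _ ↦
    ⟨fun hk4 hden ↦ ?_, fun hk6 hnum ↦ ?_⟩⟩
  · exact ratModEq_of_forall_mem_pIntegral hm.ne' fun p _ hpm ↦
      powerSum_sub_div_self_mem_pIntegral hk2 hke hm.ne' hpm
  · refine ratModEq_pow_of_forall_mem_pIntegral hm.ne' fun p hp hpm ↦
      powerSum_sub_div_sq_mem_pIntegral (by lia) hke hm.ne' hpm (mem_pIntegral.mpr fun hd ↦ ?_)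
    exact Nat.not_coprime_of_dvd_of_dvd hp.out.one_lt hd hpm hgcd
  · exact ratModEq_pow_of_forall_mem_pIntegral hm.ne' fun p _ hpm ↦
      powerSum_sub_div_cube_mem_pIntegral (by lia) hke hm.ne' hpm
        (bernoulli_div_mem_pIntegral ((Int.natCast_dvd_natCast.mpr hpm).trans hdvd))
  · have := Fact.mk hp
    exact ratModEq_prime_pow_of_mem_pIntegral hm.ne' hpr fun hpm ↦
      powerSum_sub_div_sq_mem_pIntegral (by lia) hke hm.ne' hpm (mem_pIntegral.mpr hden)
  · have := Fact.mk hp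
    exact ratModEq_prime_pow_of_mem_pIntegral hm.ne' hpr fun hpm ↦
      powerSum_sub_div_cube_mem_pIntegral (by lia) hke hm.ne' hpm
        (bernoulli_div_mem_pIntegral hnum)
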